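/- Let $n\ge 0$ and let $w:\mathbb R^n\to[1,\infty)$ be a weight function, i.e. $w\in L^\infty_{loc}(\mathbb R^n)$ (measurable and essentially bounded on every compact set) and $w(x+y)\le w(x)w(y)$ for all $x,y\in\mathbb R^n$. Assume that $w$ satisfies the Beurling–Domar condition $$\sum_{m=1}^\infty \frac{\log w(mx)}{m^2}<\infty\qquad\text{for all }x\in\mathbb R^n,$$ and that $S(\mathbb R^n)\subset L^1_w(\mathbb R^n)$, where $S(\mathbb R^n)$ is the Schwartz space and $L^1_w(\mathbb R^n)=\{f\in L^1(\mathbb R^n):\int |f|\,w\,dx<\infty\}$. Let $\varphi\in L^\infty_w(\mathbb R^n)$, i.e. $\varphi:\mathbb R^n\to\mathbb C$ is in $L^\infty_{loc}(\mathbb R^n)$ and $\operatorname{ess\,sup}_x |\varphi(x)|/w(x)<\infty$. Identify the dual group of $\mathbb R^n$ with $\mathbb R^n$, $\gamma$ corresponding to the character $x\mapsto e^{2\pi i x\cdot\gamma}$, and for $f\in L^1(\mathbb R^n)$ put $\hat f(\gamma)=\int f(x)e^{-2\pi i x\cdot\gamma}\,dx$ and $f^*(x)=\overline{f(-x)}$.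 The Beurling spectrum of $\varphi$ is $$sp_w(\varphi)=\{\gamma\in\mathbb R^n:\hat f(\gamma)=0\text{ for all } f\in L^1_w(\mathbb R^n)\text{ with } f^{*}*\varphi=0\text{ a.e.}\},$$ where $f^{*}*\varphi(x)=\int f^*(y)\varphi(x-y)\,dy$. Then $T_\varphi(g)=\int g(t)\varphi(t)\,dt$ $(g\in S(\mathbb R^n))$ converges absolutely and defines a tempered distribution $T_\varphi$, and, with $\widehat T_\varphi(g)=T_\varphi(\hat g)$ its Fourier transform, $$sp_w(\varphi)=\operatorname{supp}\widehat T_\varphi .$$ -/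

import Mathlib

open MeasureTheory
open scoped FourierTransform SchwartzMap ComplexConjugate

namespace BeurlingSpectrum

/-- `φ` belongs to `L^∞_loc(ℝⁿ)`: `χ_K φ ∈ L^∞(ℝⁿ)` for every compact set `K`. -/
def MemLinftyLoc {n : ℕ} {𝕜 : Type*} [NormedAddCommGroup 𝕜]
    (φ : EuclideanSpace ℝ (Fin n) → 𝕜) : Prop :=
  ∀ K : Set (EuclideanSpace ℝ (Fin n)), IsCompact K → MemLp (K.indicator φ) ⊤ volume

/-- Weight functions on `ℝⁿ`: functions in `L^∞_loc` that are everywhere at least `1` and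
submultiplicative. -/
structure IsWeight {n : ℕ} (w : EuclideanSpace ℝ (Fin n) → ℝ) : Prop where
  memLinftyLoc : MemLinftyLoc w
  one_le : ∀ x, 1 ≤ w x
  submul : ∀ x y, w (x + y) ≤ w x * w y

/-- The Beurling-Domar condition `∑_{m ≥ 1} log w(m x) / m² < ∞` for all `x`.
For a weight all the terms are nonnegative. -/
def BeurlingDomar {n : ℕ} (w : EuclideanSpace ℝ (Fin n) → ℝ) : Prop :=
  ∀ x, Summable fun m : ℕ => Real.log (w (((m : ℝ) + 1) • x)) / ((m : ℝ) + 1) ^ 2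

/-- The functions in `L¹_w(ℝⁿ)`: those `f ∈ L¹(ℝⁿ)` for which `∫ |f| w < ∞`. -/
def L1w {n : ℕ} (w : EuclideanSpace ℝ (Fin n) → ℝ) : Set (EuclideanSpace ℝ (Fin n) → ℂ) :=
  {f | Integrable f volume ∧ Integrable (fun x => ‖f x‖ * w x) volume}

/-- `φ` belongs to `L^∞_w(ℝⁿ)`: `φ ∈ L^∞_loc(ℝⁿ)` and `|φ| / w` is essentially bounded. -/
def MemLinftyW {n : ℕ} (w : EuclideanSpace ℝ (Fin n) → ℝ)
    (φ : EuclideanSpace ℝ (Fin n) → ℂ) : Prop :=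
  MemLinftyLoc φ ∧ ∃ C : ℝ, ∀ᵐ x, ‖φ x‖ / w x ≤ C

/-- The involution `f*(x) = conj (f (-x))`. -/
noncomputable def involution {n : ℕ} (f : EuclideanSpace ℝ (Fin n) → ℂ) :
    EuclideanSpace ℝ (Fin n) → ℂ :=
  fun x => conj (f (-x))

/-- The functions `f ∈ F` with `f* ⋆ φ = 0` almost everywhere, where
`(f* ⋆ φ)(x) = ∫ f*(y) φ(x - y) dy`. -/
def annihilator {n : ℕ} (F : Set (EuclideanSpace ℝ (Fin n) → ℂ))
    (φ : EuclideanSpace ℝ (Fin n) → ℂ) : Set (EuclideanSpace ℝ (Fin n) → ℂ) :=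
  {f | f ∈ F ∧ ∀ᵐ x, (∫ y, involution f y * φ (x - y)) = 0}

/-- The spectrum of `φ` relative to `F`: the hull of the annihilator, that is, the common zeros of
the Fourier transforms of its elements. The dual group of `ℝⁿ` is identified with `ℝⁿ`
by letting `γ` stand for the character `x ↦ exp (2πi ⟪x, γ⟫)`, so that
`𝓕 f γ = ∫ exp (-2πi ⟪x, γ⟫) f(x) dx`. -/
def relSpectrum {n : ℕ} (F : Set (EuclideanSpace ℝ (Fin n) → ℂ))
    (φ : EuclideanSpace ℝ (Fin n) → ℂ) : Set (EuclideanSpace ℝ (Fin n)) :=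
  {γ | ∀ f ∈ annihilator F φ, 𝓕 f γ = 0}

/-- The Beurling spectrum `sp_w(φ)`: the spectrum of `φ` relative to `L¹_w(ℝⁿ)`. -/
def beurlingSpectrum {n : ℕ} (w : EuclideanSpace ℝ (Fin n) → ℝ)
    (φ : EuclideanSpace ℝ (Fin n) → ℂ) : Set (EuclideanSpace ℝ (Fin n)) :=
  relSpectrum (L1w w) φ

/-- `T` is the tempered distribution `T_φ(g) = ∫ g φ` defined by the function `φ`, the integrals
being absolutely convergent. -/
def IsDistributionOf {n : ℕ} (T : 𝓢'(EuclideanSpace ℝ (Fin n), ℂ))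
    (φ : EuclideanSpace ℝ (Fin n) → ℂ) : Prop :=
  ∀ g : 𝓢(EuclideanSpace ℝ (Fin n), ℂ),
    Integrable (fun t => g t * φ t) volume ∧ T g = ∫ t, g t * φ t

end BeurlingSpectrum

/-! The inclusion of the Schwartz space in `L1w w` forces `w` to grow at most polynomially
(`IsWeight.exists_le_pow`): otherwise small multiples of bumps, centred where `w` is too large,
would sum to a Schwartz function of infinite weighted norm. Hence `φ` has polynomial growth and T_φ
is tempered.

If γ lies off the support of the transform of T_φ, take a bump χ at γ and f = 𝓕⁻ χ. Each value of f*
⋆ φ is the transform of T_φ tested on a modulation of χ, hence zero, while 𝓕 f γ = 1. So γ is not in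
the spectrum.

Conversely, let f* ⋆ φ = 0 and 𝓕 f γ ≠ 0; put h = f* and a = |𝓕 h γ|. A local Wiener lemma
(`exists_forall_convolution_fourierInv_eq_zero`) shows that the transform of T_φ vanishes near γ.
Split h = h₁ + h₂ with h₁ compactly supported and h₂ small in weighted L¹. Then 𝓕 h₁ is smooth and
has near γ a smooth inverse q with |q| ≤ 2/a. For g supported near γ put ψ_m = 𝓕⁻(q^m g) ⋆ φ; since
h ⋆ φ = 0, ψ_m = -h₂ ⋆ ψ_{m+1}. Each such step gains a factor a/8, whereas ψ_m grows at most like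
(4/a)^m, because Schwartz seminorms control the weighted norms when `w` is polynomially bounded.
Thus ψ_0 = 0. -/

open Filter Topology Convolution
open scoped ContDiff

/-! ### Series and translates of Schwartz functions -/

namespace SchwartzMap

variable {E F : Type*} [NormedAddCommGroup E] [NormedSpace ℝ E] [NormedAddCommGroup F]
  [NormedSpace ℝ F] [CompleteSpace F]

/-- A series of Schwartz functions converges to a Schwartz function when all the series of
seminorms converge. -/
theorem exists_hasSum_of_summable_seminorm (f : ℕ → 𝓢(E, F))
    (hf : ∀ p q : ℕ, Summable fun k => SchwartzMap.seminorm ℝ p q (f k)) :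
    ∃ g : 𝓢(E, F), ∀ x, HasSum (fun k => f k x) (g x) := by
  have hsm : ∀ i, ContDiff ℝ ((⊤ : ℕ∞) : WithTop ℕ∞) (f i) := fun i => (f i).smooth ⊤
  have hv : ∀ k : ℕ, (k : ℕ∞) ≤ ⊤ → Summable fun i => SchwartzMap.seminorm ℝ 0 k (f i) :=
    fun k _ => hf 0 k
  have hb : ∀ (k : ℕ) (i : ℕ) (x : E), (k : ℕ∞) ≤ ⊤ →
      ‖iteratedFDeriv ℝ k (f i) x‖ ≤ SchwartzMap.seminorm ℝ 0 k (f i) := fun k i x _ =>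
    (f i).norm_iteratedFDeriv_le_seminorm ℝ k x
  refine ⟨⟨fun x => ∑' k, f k x, contDiff_tsum hsm hv hb, fun p q =>
    ⟨∑' k, SchwartzMap.seminorm ℝ p q (f k), fun x => ?_⟩⟩, fun x => ?_⟩
  · rw [iteratedFDeriv_tsum_apply hsm hv hb le_top]
    have h1 : Summable fun k => ‖iteratedFDeriv ℝ q (f k) x‖ :=
      (hf 0 q).of_nonneg_of_le (fun _ => norm_nonneg _) fun k => hb q k x le_top
    calc ‖x‖ ^ p * ‖∑' k, iteratedFDeriv ℝ q (f k) x‖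
        ≤ ‖x‖ ^ p * ∑' k, ‖iteratedFDeriv ℝ q (f k) x‖ := by
          gcongr; exact norm_tsum_le_tsum_norm h1
      _ = ∑' k, ‖x‖ ^ p * ‖iteratedFDeriv ℝ q (f k) x‖ := tsum_mul_left.symm
      _ ≤ _ := (h1.mul_left _).tsum_le_tsum (fun k => (f k).le_seminorm ℝ p q x) (hf p q)
  · have : Summable fun k => f k x :=
      Summable.of_norm_bounded (hf 0 0) fun k => (f k).norm_le_seminorm ℝ x
    exact this.hasSum

-- The power of `1 + ‖a‖` depends only on `p`, so coefficients decaying like `(1 + ‖a k‖) ^ (-k)`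
-- eventually absorb it for every seminorm.
omit [CompleteSpace F] in
theorem exists_seminorm_compSubConstCLM_le (f : 𝓢(E, F)) (p q : ℕ) :
    ∃ K : ℝ, 0 ≤ K ∧ ∀ a : E,
      SchwartzMap.seminorm ℝ p q (compSubConstCLM ℝ a f) ≤ K * (1 + ‖a‖) ^ p := by
  refine ⟨2 ^ p * (Finset.Iic (p, q)).sup (fun m => SchwartzMap.seminorm ℝ m.1 m.2) f,
    mul_nonneg (by positivity) (apply_nonneg _ _), fun a => ?_⟩
  have hK : 0 ≤ 2 ^ p * (Finset.Iic (p, q)).sup (fun m => SchwartzMap.seminorm ℝ m.1 m.2) f :=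
    mul_nonneg (by positivity) (apply_nonneg _ _)
  refine seminorm_le_bound ℝ p q _ (by positivity) fun x => ?_
  have h1 : iteratedFDeriv ℝ q (compSubConstCLM ℝ a f) x = iteratedFDeriv ℝ q f (x - a) := by
    rw [← iteratedFDeriv_comp_sub]
    rfl
  have h2 := one_add_le_sup_seminorm_apply (𝕜 := ℝ) (m := (p, q)) le_rfl le_rfl f (x - a)
  have h3 : ‖x‖ ≤ (1 + ‖x - a‖) * (1 + ‖a‖) := by
    have := norm_add_le (x - a) a
    rw [sub_add_cancel] at this
    nlinarith [norm_nonneg (x - a), norm_nonneg a]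
  rw [h1]
  calc ‖x‖ ^ p * ‖iteratedFDeriv ℝ q f (x - a)‖
      ≤ ((1 + ‖x - a‖) * (1 + ‖a‖)) ^ p * ‖iteratedFDeriv ℝ q f (x - a)‖ := by gcongr
    _ = ((1 + ‖x - a‖) ^ p * ‖iteratedFDeriv ℝ q f (x - a)‖) * (1 + ‖a‖) ^ p := by rw [mul_pow]; ring
    _ ≤ _ := by gcongr

end SchwartzMap

/-! ### Polynomial growth of the weight -/

namespace BeurlingSpectrum

variable {n : ℕ}

theorem MemLinftyLoc.aestronglyMeasurable {𝕜 : Type*} [NormedAddCommGroup 𝕜]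
    {φ : EuclideanSpace ℝ (Fin n) → 𝕜} (hφ : MemLinftyLoc φ) : AEStronglyMeasurable φ volume := by
  have h := (aestronglyMeasurable_iUnion_iff (μ := volume) (f := φ)
    (s := fun k : ℕ => Metric.closedBall (0 : EuclideanSpace ℝ (Fin n)) k)).2 fun k =>
      (aestronglyMeasurable_indicator_iff measurableSet_closedBall).1
        (hφ _ (isCompact_closedBall 0 (k : ℝ))).1
  rwa [Metric.iUnion_closedBall_nat, Measure.restrict_univ] at h

theorem IsWeight.pos {w : EuclideanSpace ℝ (Fin n) → ℝ} (hw : IsWeight w)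
    (x : EuclideanSpace ℝ (Fin n)) : 0 < w x := zero_lt_one.trans_le (hw.one_le x)

theorem IsWeight.exists_ae_le {w : EuclideanSpace ℝ (Fin n) → ℝ} (hw : IsWeight w) :
    ∃ M : ℝ, 0 < M ∧ ∀ᵐ y, y ∈ Metric.closedBall (0 : EuclideanSpace ℝ (Fin n)) 1 → w y ≤ M := by
  obtain ⟨-, h⟩ := hw.memLinftyLoc _ (isCompact_closedBall 0 1)
  obtain ⟨C, hC⟩ := eLpNormEssSup_lt_top_iff_isBoundedUnder.1 (by rwa [eLpNorm_exponent_top] at h)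
  refine ⟨C + 1, by positivity, ?_⟩
  filter_upwards [eventually_map.1 hC] with y hy hmem
  rw [Set.indicator_of_mem hmem] at hy
  have : ‖w y‖ ≤ C := mod_cast hy
  linarith [le_abs_self (w y), Real.norm_eq_abs (w y)]

/-- A weight for which the Schwartz space is contained in `L¹_w` grows at most polynomially. -/
theorem IsWeight.exists_le_pow {w : EuclideanSpace ℝ (Fin n) → ℝ} (hw : IsWeight w)
    (hS : ∀ g : 𝓢(EuclideanSpace ℝ (Fin n), ℂ), ⇑g ∈ L1w w) :
    ∃ (C : ℝ) (N : ℕ), 0 < C ∧ ∀ x, w x ≤ C * (1 + ‖x‖) ^ N := by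
  obtain ⟨M, hM0, hM⟩ := hw.exists_ae_le
  let b : ContDiffBump (0 : EuclideanSpace ℝ (Fin n)) := ⟨1 / 2, 1, by norm_num, by norm_num⟩
  have hBc : HasCompactSupport fun x => (b x : ℂ) := b.hasCompactSupport.comp_left Complex.ofReal_zero
  let B : 𝓢(EuclideanSpace ℝ (Fin n), ℂ) :=
    hBc.toSchwartzMap (Complex.ofRealCLM.contDiff.comp b.contDiff)
  have hB : ∀ x, B x = (b x : ℂ) := fun x => rfl
  have hBn : ∀ x, ‖B x‖ = b x := fun x => by
    rw [hB, Complex.norm_real, Real.norm_of_nonneg b.nonneg]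
  -- On the support of the bump translated to `x`, almost everywhere `w x ≤ w y * w (x - y) ≤ M * w
  -- y`.
  have hlow : ∀ x, w x * ∫ y, b y ≤ M * ∫ y, ‖SchwartzMap.compSubConstCLM ℝ x B y‖ * w y := by
    intro x
    have hM' : ∀ᵐ y, x - y ∈ Metric.closedBall (0 : EuclideanSpace ℝ (Fin n)) 1 → w (x - y) ≤ M :=
      (quasiMeasurePreserving_sub_left_of_right_invariant volume x).ae hM
    rw [← integral_sub_right_eq_self _ x, ← integral_const_mul, ← integral_const_mul]
    refine integral_mono_ae ?_ ((hS _).2.const_mul M) ?_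
    · exact (b.integrable.comp_sub_right x).const_mul _
    · filter_upwards [hM'] with y hy
      simp only [SchwartzMap.compSubConstCLM_apply, hBn]
      by_cases hyx : x - y ∈ Metric.closedBall (0 : EuclideanSpace ℝ (Fin n)) 1
      · have h1 := hw.submul y (x - y)
        rw [add_sub_cancel] at h1
        have h2 : w x ≤ M * w y := by nlinarith [hy hyx, hw.pos y]
        nlinarith [b.nonneg (x := y - x)]
      · have : b (y - x) = 0 := by
          refine b.zero_of_le_dist ?_
          simp only [Metric.mem_closedBall, not_le] at hyx
          rw [dist_zero_right] at hyx ⊢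
          rw [norm_sub_rev]
          exact hyx.le
        simp [this]
  have hb0 : 0 < ∫ y, b y := b.integral_pos
  by_contra! hcon
  -- The factor `2 ^ k` pays for convergence of the series and `(1 + ‖a k‖) ^ k` for the
  -- translation; the remaining `k + 1` makes the weighted norms of the terms unbounded.
  choose a ha using fun k : ℕ => hcon (2 ^ k * (k + 1)) k (by positivity)
  let c : ℕ → ℝ := fun k => (2 ^ k * (1 + ‖a k‖) ^ k)⁻¹
  have hc0 : ∀ k, 0 < c k := fun k => by positivity
  let f : ℕ → 𝓢(EuclideanSpace ℝ (Fin n), ℂ) := fun k =>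
    c k • SchwartzMap.compSubConstCLM ℝ (a k) B
  have hfs : ∀ p q : ℕ, Summable fun k => SchwartzMap.seminorm ℝ p q (f k) := by
    intro p q
    obtain ⟨K, hK0, hK⟩ := SchwartzMap.exists_seminorm_compSubConstCLM_le B p q
    refine Summable.of_norm_bounded_eventually_nat
      (g := fun k => K * (1 / 2) ^ k) (summable_geometric_two.mul_left K) ?_
    filter_upwards [eventually_ge_atTop p] with k hk
    rw [Real.norm_of_nonneg (apply_nonneg _ _), map_smul_eq_mul, Real.norm_of_nonneg (hc0 k).le]
    calc c k * SchwartzMap.seminorm ℝ p q (SchwartzMap.compSubConstCLM ℝ (a k) B)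
        ≤ c k * (K * (1 + ‖a k‖) ^ k) := by
          have := hc0 k
          gcongr
          refine (hK _).trans ?_
          gcongr
          linarith [norm_nonneg (a k)]
      _ = K * (1 / 2) ^ k := by
          have : (1 + ‖a k‖) ≠ 0 := by positivity
          simp only [c, one_div, inv_pow]
          field_simp
  obtain ⟨g, hg⟩ := SchwartzMap.exists_hasSum_of_summable_seminorm f hfs
  have hfx : ∀ k x, f k x = ((c k * b (x - a k) : ℝ) : ℂ) := fun k x => by
    simp [f, hB]
  -- The terms are nonnegative, so nothing cancels and the sum dominates each of them.
  have hfg : ∀ k x, ‖f k x‖ ≤ ‖g x‖ := by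
    intro k x
    have h1 : HasSum (fun k => c k * b (x - a k)) (g x).re := by
      have := Complex.hasSum_re (hg x)
      simpa only [hfx, Complex.ofReal_re] using this
    rw [hfx, Complex.norm_real, Real.norm_of_nonneg (mul_nonneg (hc0 k).le b.nonneg)]
    exact (le_hasSum h1 k fun j _ => mul_nonneg (hc0 j).le b.nonneg).trans (Complex.re_le_norm _)
  have hlarge : ∀ k : ℕ, (k : ℝ) * ((∫ y, b y) / M) ≤ ∫ y, ‖g y‖ * w y := by
    intro k
    have h1 : ∫ y, ‖f k y‖ * w y ≤ ∫ y, ‖g y‖ * w y :=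
      integral_mono (hS _).2 (hS _).2 fun y => mul_le_mul_of_nonneg_right (hfg k y) (hw.pos y).le
    refine le_trans ?_ h1
    have h2 : ∫ y, ‖f k y‖ * w y =
        c k * ∫ y, ‖SchwartzMap.compSubConstCLM ℝ (a k) B y‖ * w y := by
      rw [← integral_const_mul]
      refine integral_congr_ae (Eventually.of_forall fun y => ?_)
      simp only [f, smul_apply, norm_smul, Real.norm_of_nonneg (hc0 k).le, mul_assoc]
    have h3 : (k : ℝ) ≤ c k * w (a k) := by
      have h4 : c k * (2 ^ k * (k + 1) * (1 + ‖a k‖) ^ k) ≤ c k * w (a k) :=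
        mul_le_mul_of_nonneg_left (ha k).le (hc0 k).le
      have h5 : c k * (2 ^ k * (k + 1) * (1 + ‖a k‖) ^ k) = k + 1 := by
        have : (1 + ‖a k‖) ≠ 0 := by positivity
        simp only [c]
        field_simp
      linarith
    rw [h2, mul_div_assoc', div_le_iff₀ hM0]
    calc k * ∫ y, b y ≤ c k * w (a k) * ∫ y, b y := by gcongr
      _ = c k * (w (a k) * ∫ y, b y) := by ring
      _ ≤ c k * (M * ∫ y, ‖SchwartzMap.compSubConstCLM ℝ (a k) B y‖ * w y) :=
          mul_le_mul_of_nonneg_left (hlow _) (hc0 k).le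
      _ = _ := by ring
  obtain ⟨k, hk⟩ := exists_nat_gt ((∫ y, ‖g y‖ * w y) / ((∫ y, b y) / M))
  rw [div_lt_iff₀ (by positivity)] at hk
  exact absurd (hlarge k) (not_le.2 hk)

end BeurlingSpectrum

/-! ### Weighted norms of Schwartz functions and powers of a multiplier -/

namespace SchwartzMap

section Weighted

variable {E : Type*} [NormedAddCommGroup E] [NormedSpace ℝ E] [MeasurableSpace E] [BorelSpace E]
  [SecondCountableTopology E] {μ : Measure E} [μ.HasTemperateGrowth]

/-- Polynomially weighted `L¹` norms are bounded by finitely many Schwartz seminorms. -/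
theorem exists_integral_one_add_pow_mul_le (μ : Measure E) [μ.HasTemperateGrowth] (N : ℕ) :
    ∃ (s : Finset (ℕ × ℕ)) (C : ℝ), 0 ≤ C ∧ ∀ g : 𝓢(E, ℂ),
      Integrable (fun x => (1 + ‖x‖) ^ N * ‖g x‖) μ ∧
      ∫ x, (1 + ‖x‖) ^ N * ‖g x‖ ∂μ ≤ C * s.sup (schwartzSeminormFamily ℂ E ℂ) g := by
  have hint := μ.integrable_pow_neg_integrablePower
  -- Spending `r` further powers of decay leaves an integrable factor.
  set r := μ.integrablePower with hr
  set A : ℝ := 2 ^ (N + r)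
  set J : ℝ := ∫ x, (1 + ‖x‖) ^ (-(r : ℝ)) ∂μ
  have hJ : 0 ≤ J := integral_nonneg fun x => by positivity
  refine ⟨Finset.Iic (N + r, 0), A * J, by positivity, fun g => ?_⟩
  set S : ℝ := (Finset.Iic (N + r, 0)).sup (schwartzSeminormFamily ℂ E ℂ) g
  have hb : ∀ x, (1 + ‖x‖) ^ N * ‖g x‖ ≤ A * S * (1 + ‖x‖) ^ (-(r : ℝ)) := by
    intro x
    have h1 := one_add_le_sup_seminorm_apply (𝕜 := ℂ) (m := (N + r, 0)) le_rfl le_rfl g x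
    rw [norm_iteratedFDeriv_zero] at h1
    have hx : 0 < 1 + ‖x‖ := by positivity
    rw [Real.rpow_neg hx.le, Real.rpow_natCast, ← div_eq_mul_inv, le_div_iff₀ (by positivity)]
    calc (1 + ‖x‖) ^ N * ‖g x‖ * (1 + ‖x‖) ^ r = (1 + ‖x‖) ^ (N + r) * ‖g x‖ := by
          rw [pow_add]; ring
      _ ≤ A * S := h1
  have hi : Integrable (fun x => (1 + ‖x‖) ^ N * ‖g x‖) μ := by
    refine (hint.const_mul (A * S)).mono' (by fun_prop) (Eventually.of_forall fun x => ?_)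
    rw [Real.norm_of_nonneg (by positivity)]
    exact hb x
  refine ⟨hi, (integral_mono hi (hint.const_mul (A * S)) hb).trans_eq ?_⟩
  rw [integral_const_mul]
  ring

/-- A measurable function of polynomial growth defines a tempered distribution. -/
theorem _root_.TemperedDistribution.exists_forall_eq_integral_mul {φ : E → ℂ} {C : ℝ} {N : ℕ}
    (hφ : AEStronglyMeasurable φ μ) (hb : ∀ᵐ x ∂μ, ‖φ x‖ ≤ C * (1 + ‖x‖) ^ N) :
    ∃ T : 𝓢'(E, ℂ), ∀ g : 𝓢(E, ℂ),
      Integrable (fun x => g x * φ x) μ ∧ T g = ∫ x, g x * φ x ∂μ := by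
  obtain ⟨s, K, hK, h⟩ := exists_integral_one_add_pow_mul_le μ N
  have hb' : ∀ g : 𝓢(E, ℂ), ∀ᵐ x ∂μ, ‖g x * φ x‖ ≤ |C| * ((1 + ‖x‖) ^ N * ‖g x‖) := by
    intro g
    filter_upwards [hb] with x hx
    have : ‖φ x‖ ≤ |C| * (1 + ‖x‖) ^ N := hx.trans (by gcongr; exact le_abs_self C)
    rw [norm_mul]
    nlinarith [norm_nonneg (g x)]
  have hi : ∀ g : 𝓢(E, ℂ), Integrable (fun x => g x * φ x) μ := fun g =>
    ((h g).1.const_mul |C|).mono' (g.continuous.aestronglyMeasurable.mul hφ) (hb' g)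
  let T : 𝓢(E, ℂ) →L[ℂ] ℂ := mkCLMtoNormedSpace (fun g => ∫ x, g x * φ x ∂μ)
    (fun f g => by
      simp only [add_apply, add_mul]
      exact integral_add (hi f) (hi g))
    (fun a f => by
      simp only [smul_apply, smul_eq_mul, mul_assoc, RingHom.id_apply]
      exact integral_const_mul a _)
    ⟨s, |C| * K, by positivity, fun g => by
      refine (norm_integral_le_of_norm_le ((h g).1.const_mul |C|) (hb' g)).trans ?_
      rw [integral_const_mul, mul_assoc]
      gcongr
      exact (h g).2⟩
  exact ⟨ContinuousLinearMap.toPointwiseConvergenceCLM ℂ _ _ _ T, fun g => ⟨hi g, rfl⟩⟩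

end Weighted

variable {E : Type*} [NormedAddCommGroup E] [NormedSpace ℝ E]

/-- For `‖q‖ ≤ c` the derivatives of `q ^ m * g` grow at most like `(2 c) ^ m`. -/
theorem exists_norm_iteratedFDeriv_le_pow {q g : 𝓢(E, ℂ)} {c : ℝ} (hc : 0 < c)
    (hq : ∀ x, ‖q x‖ ≤ c) (k : ℕ) :
    ∃ K : ℝ, 0 ≤ K ∧ ∀ m, ∀ j ≤ k, ∀ x,
      ‖iteratedFDeriv ℝ j (⇑((smulLeftCLM ℂ q)^[m] g)) x‖ ≤ K * (2 * c) ^ m := by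
  obtain ⟨D, hD0, hD⟩ : ∃ D : ℝ, 0 ≤ D ∧ ∀ i ≤ k, ∀ x, ‖iteratedFDeriv ℝ i q x‖ ≤ D := by
    refine ⟨∑ i ∈ Finset.range (k + 1), SchwartzMap.seminorm ℝ 0 i q,
      Finset.sum_nonneg fun i _ => apply_nonneg _ _, fun i hi x => ?_⟩
    exact (norm_iteratedFDeriv_le_seminorm ℝ q i x).trans
      (Finset.single_le_sum (f := fun i => SchwartzMap.seminorm ℝ 0 i q)
        (fun i _ => apply_nonneg _ _) (Finset.mem_range.2 (by omega)))
  obtain ⟨G, hG0, hG⟩ : ∃ D : ℝ, 0 ≤ D ∧ ∀ i ≤ k, ∀ x, ‖iteratedFDeriv ℝ i g x‖ ≤ D := by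
    refine ⟨∑ i ∈ Finset.range (k + 1), SchwartzMap.seminorm ℝ 0 i g,
      Finset.sum_nonneg fun i _ => apply_nonneg _ _, fun i hi x => ?_⟩
    exact (norm_iteratedFDeriv_le_seminorm ℝ g i x).trans
      (Finset.single_le_sum (f := fun i => SchwartzMap.seminorm ℝ 0 i g)
        (fun i _ => apply_nonneg _ _) (Finset.mem_range.2 (by omega)))
  -- The j-th derivative is measured with the factor `δ ^ j`. In the Leibniz formula the
  -- undifferentiated `q` then contributes at most `c`, and all terms with derivatives of `q`, each
  -- carrying a factor `δ`, at most `δ * (2 ^ k * D) ≤ c`. So each multiplication by `q` costs `2 *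
  -- c`, whatever the order.
  obtain ⟨δ, hδ0, hδ1, hδ⟩ : ∃ δ : ℝ, 0 < δ ∧ δ ≤ 1 ∧ δ * (2 ^ k * D) ≤ c := by
    refine ⟨min 1 (c / (2 ^ k * D + 1)), by positivity, min_le_left _ _, ?_⟩
    calc min 1 (c / (2 ^ k * D + 1)) * (2 ^ k * D) ≤ c / (2 ^ k * D + 1) * (2 ^ k * D + 1) := by
          gcongr
          · exact min_le_right _ _
          · linarith
      _ = c := by field_simp
  have key : ∀ m, ∀ j ≤ k, ∀ x,
      δ ^ j * ‖iteratedFDeriv ℝ j (⇑((smulLeftCLM ℂ q)^[m] g)) x‖ ≤ G * (2 * c) ^ m := by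
    intro m
    induction m with
    | zero =>
      intro j hj x
      simp only [Function.iterate_zero, id, pow_zero, mul_one]
      calc δ ^ j * ‖iteratedFDeriv ℝ j g x‖ ≤ 1 * G := by
            gcongr
            · exact pow_le_one₀ hδ0.le hδ1
            · exact hG j hj x
        _ = G := one_mul G
    | succ m ih =>
      intro j hj x
      rw [Function.iterate_succ_apply']
      set v := (smulLeftCLM ℂ q)^[m] g with hv
      have h1 : (⇑(smulLeftCLM ℂ q v) : E → ℂ) = fun y => q y * v y := by
        rw [smulLeftCLM_apply q.hasTemperateGrowth]
        rfl
      have h2 : ‖iteratedFDeriv ℝ j (fun y => q y * v y) x‖ ≤ _ :=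
        norm_iteratedFDeriv_mul_le (N := ∞) (q.smooth ⊤) (v.smooth ⊤) x (mod_cast le_top)
      rw [h1]
      have hcoef : ∀ i ∈ Finset.range (j + 1),
          δ ^ j * ((j.choose i : ℝ) * ‖iteratedFDeriv ℝ i q x‖ * ‖iteratedFDeriv ℝ (j - i) v x‖) ≤
          (j.choose i : ℝ) * (δ ^ i * ‖iteratedFDeriv ℝ i q x‖) * (G * (2 * c) ^ m) := by
        intro i hi
        have hij : i ≤ j := by simpa [Nat.lt_succ_iff] using hi
        have hpow : δ ^ j = δ ^ i * δ ^ (j - i) := by rw [← pow_add, Nat.add_sub_cancel' hij]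
        calc _ = (j.choose i : ℝ) * (δ ^ i * ‖iteratedFDeriv ℝ i q x‖) *
              (δ ^ (j - i) * ‖iteratedFDeriv ℝ (j - i) v x‖) := by rw [hpow]; ring
          _ ≤ _ := mul_le_mul_of_nonneg_left (ih (j - i) (by omega) x) (by positivity)
      have hsum : ∑ i ∈ Finset.range (j + 1),
          (j.choose i : ℝ) * (δ ^ i * ‖iteratedFDeriv ℝ i q x‖) ≤ 2 * c := by
        rw [Finset.sum_range_succ']
        have h0 : ‖iteratedFDeriv ℝ 0 q x‖ ≤ c := by rw [norm_iteratedFDeriv_zero]; exact hq x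
        have hrest : ∑ i ∈ Finset.range j,
            (j.choose (i + 1) : ℝ) * (δ ^ (i + 1) * ‖iteratedFDeriv ℝ (i + 1) q x‖) ≤ c := by
          refine le_trans ?_ hδ
          calc _ ≤ ∑ i ∈ Finset.range j, (j.choose (i + 1) : ℝ) * (δ * D) := by
                refine Finset.sum_le_sum fun i hi => ?_
                gcongr
                · exact pow_le_of_le_one hδ0.le hδ1 (by omega)
                · exact hD _ (by have := Finset.mem_range.1 hi; omega) x
            _ = (∑ i ∈ Finset.range j, (j.choose (i + 1) : ℝ)) * (δ * D) := by
                rw [Finset.sum_mul]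
            _ ≤ 2 ^ k * (δ * D) := by
                gcongr
                have h3 : ∑ i ∈ Finset.range j, j.choose (i + 1) ≤ 2 ^ j := by
                  rw [← Nat.sum_range_choose, Finset.sum_range_succ']
                  exact Nat.le_add_right _ _
                calc (∑ i ∈ Finset.range j, (j.choose (i + 1) : ℝ)) ≤ 2 ^ j := by exact_mod_cast h3
                  _ ≤ 2 ^ k := by gcongr; norm_num
            _ = δ * (2 ^ k * D) := by ring
        simp only [pow_zero, one_mul, Nat.choose_zero_right, Nat.cast_one]
        linarith
      calc δ ^ j * ‖iteratedFDeriv ℝ j (fun y => q y * v y) x‖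
          ≤ δ ^ j * _ := mul_le_mul_of_nonneg_left h2 (by positivity)
        _ ≤ ∑ i ∈ Finset.range (j + 1), (j.choose i : ℝ) * (δ ^ i * ‖iteratedFDeriv ℝ i q x‖) *
              (G * (2 * c) ^ m) := by
            rw [Finset.mul_sum]
            exact Finset.sum_le_sum hcoef
        _ ≤ 2 * c * (G * (2 * c) ^ m) := by
            rw [← Finset.sum_mul]
            gcongr
        _ = G * (2 * c) ^ (m + 1) := by ring
  refine ⟨G / δ ^ k, by positivity, fun m j hj x => ?_⟩
  have h1 : δ ^ k * ‖iteratedFDeriv ℝ j (⇑((smulLeftCLM ℂ q)^[m] g)) x‖ ≤ G * (2 * c) ^ m := by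
    refine le_trans ?_ (key m j hj x)
    gcongr ?_ * _
    exact pow_le_pow_of_le_one hδ0.le hδ1 hj
  rw [div_mul_eq_mul_div, le_div_iff₀ (by positivity)]
  linarith

theorem iterate_smulLeftCLM_apply (q g : 𝓢(E, ℂ)) (m : ℕ) (x : E) :
    ((smulLeftCLM ℂ q)^[m] g) x = q x ^ m * g x := by
  induction m with
  | zero => simp
  | succ m ih =>
    rw [Function.iterate_succ_apply', smulLeftCLM_apply_apply q.hasTemperateGrowth, ih,
      smul_eq_mul, pow_succ]
    ring

/-- All the products are supported in the bounded set `tsupport g`, so the powers of `‖x‖` in the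
seminorms cost only a constant and the growth rate is that of the derivatives. -/
theorem exists_seminorm_iterate_smulLeftCLM_le {q g : 𝓢(E, ℂ)} {c : ℝ} (hc : 0 < c)
    (hq : ∀ x, ‖q x‖ ≤ c) (hg : Bornology.IsBounded (tsupport g)) (s : Finset (ℕ × ℕ)) :
    ∃ K : ℝ, 0 ≤ K ∧ ∀ m,
      s.sup (schwartzSeminormFamily ℂ E ℂ) ((smulLeftCLM ℂ q)^[m] g) ≤ K * (2 * c) ^ m := by
  obtain ⟨R, hR⟩ := hg.subset_closedBall 0
  choose K hK0 hK using fun k => exists_norm_iteratedFDeriv_le_pow (g := g) hc hq k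
  refine ⟨∑ p ∈ s, |R| ^ p.1 * K p.2,
    Finset.sum_nonneg fun p _ => mul_nonneg (by positivity) (hK0 _), fun m => ?_⟩
  have hsum : 0 ≤ ∑ p ∈ s, |R| ^ p.1 * K p.2 :=
    Finset.sum_nonneg fun p _ => mul_nonneg (by positivity) (hK0 _)
  refine Seminorm.finset_sup_apply_le (by positivity) fun p hp => ?_
  refine seminorm_le_bound ℂ p.1 p.2 _ (by positivity) fun x => ?_
  calc ‖x‖ ^ p.1 * ‖iteratedFDeriv ℝ p.2 (⇑((smulLeftCLM ℂ q)^[m] g)) x‖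
      ≤ |R| ^ p.1 * (K p.2 * (2 * c) ^ m) := by
        by_cases hx : x ∈ tsupport g
        · have hxR : ‖x‖ ≤ |R| := (mem_closedBall_zero_iff.1 (hR hx)).trans (le_abs_self R)
          gcongr
          exact hK p.2 m p.2 le_rfl x
        · have hx' : x ∉ tsupport ⇑((smulLeftCLM ℂ q)^[m] g) := by
            refine fun h => hx (closure_mono (fun y hy => ?_) h)
            rw [Function.mem_support, iterate_smulLeftCLM_apply] at hy
            exact right_ne_zero_of_mul hy
          have : iteratedFDeriv ℝ p.2 (⇑((smulLeftCLM ℂ q)^[m] g)) x = 0 := by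
            by_contra h0
            exact hx' (support_iteratedFDeriv_subset p.2 h0)
          rw [this, norm_zero, mul_zero]
          exact mul_nonneg (by positivity) (mul_nonneg (hK0 _) (by positivity))
    _ = |R| ^ p.1 * K p.2 * (2 * c) ^ m := by ring
    _ ≤ _ := by
        gcongr
        exact Finset.single_le_sum (f := fun p : ℕ × ℕ => |R| ^ p.1 * K p.2)
          (fun p _ => mul_nonneg (by positivity) (hK0 _)) hp

end SchwartzMap

/-! ### Convolution with functions dominated by a submultiplicative weight -/

namespace MeasureTheory

variable {E K : Type*} [NormedAddCommGroup E] [NormedSpace ℝ E] [FiniteDimensional ℝ E]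
  [MeasurableSpace E] [BorelSpace E] {μ : Measure E} [μ.IsAddHaarMeasure] [RCLike K]
  {w : E → ℝ} {u φ : E → K} {C : ℝ}

/-- This is `w (x - y) ≤ w x * w (-y)`. The reflected weight appears because `w` is not assumed
even. -/
theorem ae_norm_mul_le_of_submul (hw : ∀ x y, w (x + y) ≤ w x * w y)
    (hC : 0 ≤ C) (hφC : ∀ᵐ x ∂μ, ‖φ x‖ ≤ C * w x) (x : E) :
    ∀ᵐ y ∂μ, ‖u y * φ (x - y)‖ ≤ C * w x * (‖u y‖ * w (-y)) := by
  have h : ∀ᵐ y ∂μ, ‖φ (x - y)‖ ≤ C * w (x - y) :=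
    (quasiMeasurePreserving_sub_left_of_right_invariant μ x).ae hφC
  filter_upwards [h] with y hy
  rw [norm_mul]
  calc ‖u y‖ * ‖φ (x - y)‖ ≤ ‖u y‖ * (C * (w x * w (-y))) := by
        have := hw x (-y)
        rw [← sub_eq_add_neg] at this
        gcongr
        exact hy.trans (by gcongr)
    _ = _ := by ring

theorem convolutionExistsAt_of_submul (hw : ∀ x y, w (x + y) ≤ w x * w y)
    (hC : 0 ≤ C) (hu : AEStronglyMeasurable u μ) (hui : Integrable (fun y => ‖u y‖ * w (-y)) μ)
    (hφ : AEStronglyMeasurable φ μ) (hφC : ∀ᵐ x ∂μ, ‖φ x‖ ≤ C * w x) (x : E) :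
    ConvolutionExistsAt u φ x (ContinuousLinearMap.mul K K) μ := by
  refine (hui.const_mul (C * w x)).mono' ?_ (ae_norm_mul_le_of_submul hw hC hφC x)
  exact hu.mul (hφ.comp_quasiMeasurePreserving
    (quasiMeasurePreserving_sub_left_of_right_invariant μ x))

theorem norm_convolution_le_of_submul (hw : ∀ x y, w (x + y) ≤ w x * w y)
    (hC : 0 ≤ C) (hui : Integrable (fun y => ‖u y‖ * w (-y)) μ)
    (hφC : ∀ᵐ x ∂μ, ‖φ x‖ ≤ C * w x) (x : E) :
    ‖(u ⋆[ContinuousLinearMap.mul K K, μ] φ) x‖ ≤ C * (∫ y, ‖u y‖ * w (-y) ∂μ) * w x := by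
  refine (norm_integral_le_of_norm_le (hui.const_mul (C * w x))
    (ae_norm_mul_le_of_submul hw hC hφC x)).trans_eq ?_
  rw [integral_const_mul]
  ring

theorem AEStronglyMeasurable.convolution_mul (hu : AEStronglyMeasurable u μ)
    (hφ : AEStronglyMeasurable φ μ) :
    AEStronglyMeasurable (u ⋆[ContinuousLinearMap.mul K K, μ] φ) μ :=
  (hu.convolution_integrand (ContinuousLinearMap.mul K K) hφ).integral_prod_right'

/-- Convolution is associative on functions of suitable weighted integrability. -/
theorem convolution_assoc_of_submul {f g φ : E → ℂ} (hw1 : ∀ x, 1 ≤ w x)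
    (hw : ∀ x y, w (x + y) ≤ w x * w y) (hC : 0 ≤ C) (hf : Integrable f μ) (hg : Integrable g μ)
    (hfw : Integrable (fun y => ‖f y‖ * w (-y)) μ) (hgw : Integrable (fun y => ‖g y‖ * w (-y)) μ)
    (hφ : AEStronglyMeasurable φ μ) (hφC : ∀ᵐ x ∂μ, ‖φ x‖ ≤ C * w x) (x : E) :
    ((f ⋆[ContinuousLinearMap.mul ℂ ℂ, μ] g) ⋆[ContinuousLinearMap.mul ℂ ℂ, μ] φ) x =
      (f ⋆[ContinuousLinearMap.mul ℂ ℂ, μ] (g ⋆[ContinuousLinearMap.mul ℂ ℂ, μ] φ)) x := by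
  have hw0 : ∀ x, 0 ≤ w x := fun x => zero_le_one.trans (hw1 x)
  have hφC' : ∀ᵐ x ∂μ, ‖‖φ x‖‖ ≤ C * w x := by simpa only [norm_norm] using hφC
  have hgw' : Integrable (fun y => ‖‖g y‖‖ * w (-y)) μ := by simpa only [norm_norm] using hgw
  have hfw' : Integrable (fun y => ‖‖f y‖‖ * w (-y)) μ := by simpa only [norm_norm] using hfw
  have hI : 0 ≤ ∫ y, ‖‖g y‖‖ * w (-y) ∂μ :=
    integral_nonneg fun y => mul_nonneg (norm_nonneg _) (hw0 _)
  refine convolution_assoc _ _ _ _ (fun a b c => mul_assoc a b c) hf.1 hg.1 hφ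
    (hf.ae_convolution_exists _ hg)
    (Eventually.of_forall fun x => convolutionExistsAt_of_submul hw hC hg.1.norm hgw'
      hφ.norm hφC' x) ?_
  -- The triple integral converges absolutely because `|g| ⋆ |φ|` is again bounded by a multiple of
  -- `w`.
  exact convolutionExistsAt_of_submul hw (mul_nonneg hC hI) hf.1.norm hfw'
    (hg.1.norm.convolution_mul hφ.norm)
    (Eventually.of_forall fun x => norm_convolution_le_of_submul hw hC hgw' hφC' x) x

theorem convolution_mul_comm (f g : E → ℂ) :
    f ⋆[ContinuousLinearMap.mul ℂ ℂ, μ] g = g ⋆[ContinuousLinearMap.mul ℂ ℂ, μ] f := by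
  rw [← convolution_flip, ContinuousLinearMap.flip_mul]

end MeasureTheory

/-! ### Convolution as a Fourier multiplier -/

section Fourier

variable {E : Type*} [NormedAddCommGroup E] [InnerProductSpace ℝ E] [FiniteDimensional ℝ E]
  [MeasurableSpace E] [BorelSpace E]

/-- Convolution by an integrable function acts on inverse Fourier transforms as a multiplier. -/
theorem Real.convolution_fourierInv {h v : E → ℂ} (hh : Integrable h) (hv : Integrable v) (x : E) :
    (h ⋆[ContinuousLinearMap.mul ℂ ℂ, volume] 𝓕⁻ v) x = 𝓕⁻ (fun ξ => 𝓕 h ξ * v ξ) x := by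
  -- The modulation is chosen so that `𝓕 g y = 𝓕⁻ v (x - y)`; the identity is then the
  -- multiplication formula for `h` and `g`.
  let g : E → ℂ := fun ξ => Real.fourierChar (inner ℝ ξ x) • v ξ
  have hg : Integrable g := by
    have := (Real.fourierIntegral_convergent_iff (V := E) (f := v) (-x)).2 hv
    simpa [g, inner_neg_right] using this
  have key : ∫ ξ, 𝓕 h ξ * g ξ = ∫ y, h y * 𝓕 g y :=
    VectorFourier.integral_bilin_fourierIntegral_eq_flip (ContinuousLinearMap.mul ℂ ℂ)
      (L := innerₗ E) (μ := volume) (ν := volume) Real.continuous_fourierChar continuous_inner hh hg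
      |>.trans (by simp [Real.fourier_eq, VectorFourier.fourierIntegral, real_inner_comm])
  rw [Real.fourierInv_eq]
  change ∫ y, h y * 𝓕⁻ v (x - y) = _
  have h1 : ∀ y, 𝓕⁻ v (x - y) = 𝓕 g y := by
    intro y
    rw [Real.fourierInv_eq, Real.fourier_eq]
    refine integral_congr_ae (Eventually.of_forall fun ξ => ?_)
    simp only [g]
    rw [smul_smul, ← AddChar.map_add_eq_mul]
    congr 2
    rw [inner_sub_right]
    ring
  simp_rw [h1]
  rw [← key]
  refine integral_congr_ae (Eventually.of_forall fun ξ => ?_)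
  simp only [g, Circle.smul_def, smul_eq_mul]
  ring

end Fourier

/-! ### The local Wiener lemma -/

namespace MeasureTheory

variable {E : Type*} [NormedAddCommGroup E] [MeasurableSpace E] [BorelSpace E]
  {μ : Measure E}

theorem Integrable.exists_setIntegral_compl_closedBall_lt {f : E → ℝ} (hf : Integrable f μ)
    {ε : ℝ} (hε : 0 < ε) : ∃ k : ℕ, ∫ x in (Metric.closedBall 0 (k : ℝ))ᶜ, f x ∂μ < ε := by
  have h := tendsto_setIntegral_of_antitone (μ := μ) (f := f)
    (s := fun k : ℕ => (Metric.closedBall (0 : E) (k : ℝ))ᶜ)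
    (fun k => measurableSet_closedBall.compl)
    (fun i j hij => Set.compl_subset_compl.2 (Metric.closedBall_subset_closedBall (mod_cast hij)))
    ⟨0, hf.integrableOn⟩
  rw [← Set.compl_iUnion, Metric.iUnion_closedBall_nat, Set.compl_univ, setIntegral_empty] at h
  exact (h.eventually_lt_const hε).exists

end MeasureTheory

section Local

variable {E : Type*} [NormedAddCommGroup E] [InnerProductSpace ℝ E] [FiniteDimensional ℝ E]
  [MeasurableSpace E] [BorelSpace E]

/-- A truncated integrable function has finite moments of all orders. -/
theorem contDiff_fourier_indicator_closedBall {h : E → ℂ} (hh : Integrable h) (R : ℝ) :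
    ContDiff ℝ ∞ (𝓕 ((Metric.closedBall 0 R).indicator h)) := by
  refine Real.contDiff_fourier fun k _ => ?_
  have hi : Integrable ((Metric.closedBall 0 R).indicator h) :=
    hh.indicator measurableSet_closedBall
  refine (hi.norm.const_mul (|R| ^ k)).mono'
    ((by fun_prop : Continuous fun v : E => ‖v‖ ^ k).aestronglyMeasurable.mul hi.1.norm)
    (Eventually.of_forall fun v => ?_)
  rw [norm_mul, norm_norm, norm_pow, norm_norm]
  by_cases hv : v ∈ Metric.closedBall 0 R
  · have : ‖v‖ ≤ |R| := (mem_closedBall_zero_iff.1 hv).trans (le_abs_self R)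
    gcongr
  · simp [hv]

omit [MeasurableSpace E] [BorelSpace E] in
/-- A smooth function that is bounded below on a ball has a Schwartz inverse near the centre, with
the same bound. -/
theorem SchwartzMap.exists_mul_eq_one_of_le_norm {F : E → ℂ} (hF : ContDiff ℝ ∞ F) {γ : E}
    {c ρ : ℝ} (hc : 0 < c) (hρ : 0 < ρ) (hb : ∀ ξ ∈ Metric.ball γ ρ, c ≤ ‖F ξ‖) :
    ∃ q : 𝓢(E, ℂ), (∀ ξ, ‖q ξ‖ ≤ c⁻¹) ∧ ∀ ξ ∈ Metric.ball γ (ρ / 4), F ξ * q ξ = 1 := by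
  let χ : ContDiffBump γ := ⟨ρ / 4, ρ / 2, by positivity, by linarith⟩
  have hsupp : tsupport (fun ξ => (χ ξ : ℂ)) ⊆ Metric.ball γ ρ := by
    refine (closure_mono fun ξ hξ => ?_).trans
      (χ.tsupport_eq.trans_subset (Metric.closedBall_subset_ball (by simp only [χ]; linarith)))
    simpa using hξ
  have hχc : HasCompactSupport fun ξ => (χ ξ : ℂ) :=
    χ.hasCompactSupport.comp_left Complex.ofReal_zero
  have hχs : ContDiff ℝ ∞ fun ξ => (χ ξ : ℂ) := Complex.ofRealCLM.contDiff.comp χ.contDiff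
  have hF0 : ∀ ξ ∈ Metric.ball γ ρ, F ξ ≠ 0 := fun ξ hξ =>
    norm_pos_iff.1 (hc.trans_le (hb ξ hξ))
  have hcs : HasCompactSupport fun ξ => (χ ξ : ℂ) * (F ξ)⁻¹ := hχc.mul_right
  have hsm : ContDiff ℝ ∞ fun ξ => (χ ξ : ℂ) * (F ξ)⁻¹ := by
    refine contDiff_iff_contDiffAt.2 fun ξ => ?_
    by_cases hξ' : ξ ∈ Metric.ball γ ρ
    swap
    · refine contDiffAt_const (c := (0 : ℂ)) |>.congr_of_eventuallyEq ?_
      filter_upwards [notMem_tsupport_iff_eventuallyEq.1 fun h => hξ' (hsupp h)] with y hy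
      have hy' : (χ y : ℂ) = 0 := hy
      rw [hy', zero_mul]
    exact hχs.contDiffAt.mul (hF.contDiffAt.inv (hF0 ξ hξ'))
  refine ⟨hcs.toSchwartzMap hsm, fun ξ => ?_, fun ξ hξ => ?_⟩
  · rw [HasCompactSupport.toSchwartzMap_toFun, norm_mul, norm_inv, Complex.norm_real,
      Real.norm_of_nonneg χ.nonneg]
    by_cases hξ : ξ ∈ Metric.ball γ ρ
    · calc χ ξ * ‖F ξ‖⁻¹ ≤ 1 * c⁻¹ := by
            gcongr
            · exact χ.le_one
            · exact hb ξ hξ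
        _ = c⁻¹ := one_mul _
    · have : (χ ξ : ℂ) = 0 :=
        image_eq_zero_of_notMem_tsupport (f := fun ξ => (χ ξ : ℂ)) fun h => hξ (hsupp h)
      rw [Complex.ofReal_eq_zero.1 this, zero_mul]
      positivity
  · have h1 : χ ξ = 1 := χ.one_of_mem_closedBall (Metric.ball_subset_closedBall hξ)
    rw [HasCompactSupport.toSchwartzMap_toFun, h1, Complex.ofReal_one, one_mul]
    exact mul_inv_cancel₀ (hF0 ξ (Metric.ball_subset_ball (by linarith) hξ))

/-- If `h ⋆ φ = 0`, then the inverse Fourier transforms of test functions supported where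
`𝓕 h ≠ 0` annihilate `φ`: a local form of Wiener's lemma for polynomially bounded weights. -/
theorem exists_forall_convolution_fourierInv_eq_zero {w : E → ℝ} {C A : ℝ} {N : ℕ}
    (hw1 : ∀ x, 1 ≤ w x) (hw : ∀ x y, w (x + y) ≤ w x * w y) (hwm : AEStronglyMeasurable w volume)
    (hwN : ∀ x, w x ≤ A * (1 + ‖x‖) ^ N) {φ h : E → ℂ} (hC : 0 ≤ C)
    (hφ : AEStronglyMeasurable φ volume) (hφC : ∀ᵐ x, ‖φ x‖ ≤ C * w x) (hh : Integrable h)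
    (hhw : Integrable fun y => ‖h y‖ * w (-y))
    (hhφ : ∀ᵐ x, (h ⋆[ContinuousLinearMap.mul ℂ ℂ, volume] φ) x = 0) {γ : E} (hγ : 𝓕 h γ ≠ 0) :
    ∃ r > 0, ∀ g : 𝓢(E, ℂ), tsupport g ⊆ Metric.ball γ r →
      ((𝓕⁻ g : 𝓢(E, ℂ)) ⋆[ContinuousLinearMap.mul ℂ ℂ, volume] φ) 0 = 0 := by
  have hw0 : ∀ x, 0 ≤ w x := fun x => zero_le_one.trans (hw1 x)
  have hwm' : AEStronglyMeasurable (fun y => w (-y)) volume :=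
    hwm.comp_quasiMeasurePreserving (Measure.measurePreserving_neg volume).quasiMeasurePreserving
  have hA : 0 < A := by
    have := (hw1 0).trans (hwN 0)
    simp only [norm_zero, add_zero, one_pow, mul_one] at this
    linarith
  have ha : 0 < ‖𝓕 h γ‖ := norm_pos_iff.2 hγ
  set a := ‖𝓕 h γ‖ with ha_def
  -- The tail `a / 8` beats the growth rate `4 / a` of the weighted norms of `u m`: the product is
  -- `1 / 2`.
  obtain ⟨k, hk⟩ := hhw.exists_setIntegral_compl_closedBall_lt (show 0 < a / 8 by positivity)
  set s : Set E := Metric.closedBall 0 (k : ℝ) with hs_def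
  have hs : MeasurableSet s := measurableSet_closedBall
  set h₁ : E → ℂ := s.indicator h with h₁_def
  set h₂ : E → ℂ := sᶜ.indicator h with h₂_def
  have hadd : ∀ y, h y = h₁ y + h₂ y := fun y =>
    (congrFun (Set.indicator_self_add_compl s h) y).symm
  have hi₁ : Integrable h₁ := hh.indicator hs
  have hi₂ : Integrable h₂ := hh.indicator hs.compl
  have hiw₁ : Integrable fun y => ‖h₁ y‖ * w (-y) := by
    refine hhw.mono (hi₁.1.norm.mul hwm') (Eventually.of_forall fun y => ?_)
    rw [norm_mul, norm_mul, norm_norm, norm_norm]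
    gcongr
    exact norm_indicator_le_norm_self h y
  have hiw₂ : Integrable fun y => ‖h₂ y‖ * w (-y) := by
    refine hhw.mono (hi₂.1.norm.mul hwm') (Eventually.of_forall fun y => ?_)
    rw [norm_mul, norm_mul, norm_norm, norm_norm]
    gcongr
    exact norm_indicator_le_norm_self h y
  have hε : ∫ y, ‖h₂ y‖ * w (-y) ≤ a / 8 := by
    refine le_of_eq_of_le ?_ hk.le
    rw [← integral_indicator hs.compl]
    refine integral_congr_ae (Eventually.of_forall fun y => ?_)
    by_cases hy : y ∈ sᶜ
    · simp only [h₂_def, Set.indicator_of_mem hy]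
    · simp only [h₂_def, Set.indicator_of_notMem hy, norm_zero, zero_mul]
  have hF : ∀ ξ, ‖𝓕 h ξ - 𝓕 h₁ ξ‖ ≤ a / 8 := by
    intro ξ
    have h1 : 𝓕 h ξ - 𝓕 h₁ ξ = 𝓕 h₂ ξ := by
      rw [Real.fourier_eq, Real.fourier_eq, Real.fourier_eq, ← integral_sub]
      · refine integral_congr_ae (Eventually.of_forall fun y => ?_)
        simp only [hadd y, smul_add, add_sub_cancel_left]
      · exact (Real.fourierIntegral_convergent_iff ξ).2 hh
      · exact (Real.fourierIntegral_convergent_iff ξ).2 hi₁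
    rw [h1]
    refine le_trans ?_ hε
    rw [Real.fourier_eq]
    refine norm_integral_le_of_norm_le hiw₂ (Eventually.of_forall fun y => ?_)
    rw [Circle.norm_smul]
    exact le_mul_of_one_le_right (norm_nonneg _) (hw1 _)
  have hcont : Continuous (𝓕 h) :=
    VectorFourier.fourierIntegral_continuous Real.continuous_fourierChar
      (by exact continuous_inner) hh
  obtain ⟨ρ, hρ, hball⟩ : ∃ ρ > 0, ∀ ξ ∈ Metric.ball γ ρ, a / 2 ≤ ‖𝓕 h₁ ξ‖ := by
    have hev : ∀ᶠ ξ in 𝓝 γ, 3 / 4 * a < ‖𝓕 h ξ‖ :=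
      hcont.norm.continuousAt.eventually_const_lt (by linarith)
    obtain ⟨ρ, hρ, hball⟩ := Metric.eventually_nhds_iff_ball.1 hev
    refine ⟨ρ, hρ, fun ξ hξ => ?_⟩
    have h1 := hball ξ hξ
    have h2 := hF ξ
    have h3 := norm_sub_norm_le (𝓕 h ξ) (𝓕 h₁ ξ)
    linarith
  obtain ⟨q, hq, hq1⟩ := SchwartzMap.exists_mul_eq_one_of_le_norm
    (contDiff_fourier_indicator_closedBall hh k) (by positivity) hρ hball
  refine ⟨ρ / 4, by positivity, fun g hg => ?_⟩
  let v : ℕ → 𝓢(E, ℂ) := fun m => (SchwartzMap.smulLeftCLM ℂ q)^[m] g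
  let u : ℕ → 𝓢(E, ℂ) := fun m => 𝓕⁻ (v m)
  let ψ : ℕ → E → ℂ := fun m => u m ⋆[ContinuousLinearMap.mul ℂ ℂ, volume] φ
  obtain ⟨S, B, hB0, hB⟩ := SchwartzMap.exists_integral_one_add_pow_mul_le (volume : Measure E) N
  have hwu : ∀ (f : 𝓢(E, ℂ)) (y : E), ‖f y‖ * w (-y) ≤ A * ((1 + ‖y‖) ^ N * ‖f y‖) := by
    intro f y
    have := hwN (-y)
    rw [norm_neg] at this
    nlinarith [norm_nonneg (f y)]
  have hfw : ∀ f : 𝓢(E, ℂ), Integrable fun y => ‖f y‖ * w (-y) := by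
    intro f
    refine ((hB f).1.const_mul A).mono' (f.continuous.aestronglyMeasurable.norm.mul hwm')
      (Eventually.of_forall fun y => ?_)
    rw [Real.norm_of_nonneg (mul_nonneg (norm_nonneg _) (hw0 _))]
    exact hwu f y
  have hfI : ∀ f : 𝓢(E, ℂ), ∫ y, ‖f y‖ * w (-y) ≤
      A * (B * S.sup (schwartzSeminormFamily ℂ E ℂ) f) := by
    intro f
    refine (integral_mono (hfw f) ((hB f).1.const_mul A) (hwu f)).trans ?_
    rw [integral_const_mul]
    gcongr
    exact (hB f).2
  obtain ⟨K, hK0, hK⟩ : ∃ K : ℝ, 0 ≤ K ∧ ∀ m, ∫ y, ‖u m y‖ * w (-y) ≤ K * (4 / a) ^ m := by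
    let p : Seminorm ℂ 𝓢(E, ℂ) := (S.sup (schwartzSeminormFamily ℂ E ℂ)).comp
      (FourierTransform.fourierInvCLM ℂ 𝓢(E, ℂ)).toLinearMap
    have hsup : Continuous ⇑(S.sup (schwartzSeminormFamily ℂ E ℂ)) :=
      Seminorm.continuous_finsetSup fun i _ =>
        (schwartz_withSeminorms ℂ E ℂ).continuous_seminorm i
    have hp : Continuous p := hsup.comp (FourierTransform.fourierInvCLM ℂ 𝓢(E, ℂ)).continuous
    obtain ⟨S', D, -, hD⟩ := Seminorm.bound_of_continuous (schwartz_withSeminorms ℂ E ℂ) p hp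
    obtain ⟨K, hK0, hK⟩ := SchwartzMap.exists_seminorm_iterate_smulLeftCLM_le
      (inv_pos.2 (show 0 < a / 2 by positivity)) hq (Metric.isBounded_ball.subset hg) S'
    refine ⟨A * (B * (D * K)), by positivity, fun m => (hfI _).trans ?_⟩
    have h1 : S.sup (schwartzSeminormFamily ℂ E ℂ) (u m) ≤
        D * S'.sup (schwartzSeminormFamily ℂ E ℂ) (v m) := hD (v m)
    have h2 := hK m
    rw [show 2 * (a / 2)⁻¹ = 4 / a by field_simp; norm_num] at h2
    calc A * (B * S.sup (schwartzSeminormFamily ℂ E ℂ) (u m))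
        ≤ A * (B * (D * (K * (4 / a) ^ m))) := by
          gcongr
          exact h1.trans (by gcongr)
      _ = _ := by ring
  have hI0 : ∀ f : E → ℂ, 0 ≤ ∫ y, ‖f y‖ * w (-y) := fun f =>
    integral_nonneg fun y => mul_nonneg (norm_nonneg _) (hw0 _)
  have hψm : ∀ m, AEStronglyMeasurable (ψ m) volume := fun m =>
    (u m).continuous.aestronglyMeasurable.convolution_mul hφ
  have hψ : ∀ m x, ‖ψ m x‖ ≤ C * (∫ y, ‖u m y‖ * w (-y)) * w x := fun m x =>
    norm_convolution_le_of_submul hw hC (hfw _) hφC x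
  -- Moving `h` past `u m` makes it act on `φ`; vanishing almost everywhere there gives vanishing
  -- everywhere here.
  have hhψ : ∀ m x, (h ⋆[ContinuousLinearMap.mul ℂ ℂ, volume] ψ m) x = 0 := by
    intro m x
    rw [← convolution_assoc_of_submul hw1 hw hC hh (u m).integrable hhw (hfw _) hφ hφC x,
      convolution_mul_comm h (u m),
      convolution_assoc_of_submul hw1 hw hC (u m).integrable hh (hfw _) hhw hφ hφC x]
    refine integral_eq_zero_of_ae ?_
    have := (quasiMeasurePreserving_sub_left_of_right_invariant volume x).ae hhφ
    filter_upwards [this] with y hy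
    rw [hy]
    simp
  have hu : ∀ m, (h₁ ⋆[ContinuousLinearMap.mul ℂ ℂ, volume] u (m + 1)) = u m := by
    intro m
    ext x
    simp only [u, SchwartzMap.fourierInv_coe]
    rw [Real.convolution_fourierInv hi₁ (v (m + 1)).integrable]
    refine congrArg (fun f : E → ℂ => 𝓕⁻ f x) (funext fun ξ => ?_)
    simp only [v, SchwartzMap.iterate_smulLeftCLM_apply]
    -- `q` inverts `𝓕 h₁` only near `γ`, which suffices because `g` vanishes elsewhere.
    by_cases hξ : ξ ∈ tsupport g
    · rw [pow_succ]
      linear_combination (q ξ ^ m * g ξ) * hq1 ξ (hg hξ)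
    · simp [image_eq_zero_of_notMem_tsupport hξ]
  have hrec : ∀ m x, ψ m x = -(h₂ ⋆[ContinuousLinearMap.mul ℂ ℂ, volume] ψ (m + 1)) x := by
    intro m x
    have h1 : ψ m x = (h₁ ⋆[ContinuousLinearMap.mul ℂ ℂ, volume] ψ (m + 1)) x := by
      rw [← convolution_assoc_of_submul hw1 hw hC hi₁ (u (m + 1)).integrable hiw₁ (hfw _) hφ hφC x,
        hu]
    have hC' : 0 ≤ C * ∫ y, ‖u (m + 1) y‖ * w (-y) := mul_nonneg hC (hI0 _)
    have hae : ∀ᵐ x, ‖ψ (m + 1) x‖ ≤ C * (∫ y, ‖u (m + 1) y‖ * w (-y)) * w x :=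
      Eventually.of_forall (hψ (m + 1))
    have h2 := ConvolutionExistsAt.add_distrib
      (convolutionExistsAt_of_submul hw hC' hi₁.1 hiw₁ (hψm (m + 1)) hae x)
      (convolutionExistsAt_of_submul hw hC' hi₂.1 hiw₂ (hψm (m + 1)) hae x)
    have h3 : h₁ + h₂ = h := funext fun y => (hadd y).symm
    rw [h1, eq_neg_iff_add_eq_zero, ← h2, h3]
    exact hhψ (m + 1) x
  -- Descending from `ψ m` to `ψ 0`, each use of `hrec` multiplies the bound by the weighted norm of
  -- `h₂`.
  have hdecay : ∀ m, ∀ D : ℝ, 0 ≤ D → (∀ x, ‖ψ m x‖ ≤ D * w x) →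
      ∀ x, ‖ψ 0 x‖ ≤ D * (a / 8) ^ m * w x := by
    intro m
    induction m with
    | zero => intro D _ hD x; simpa using hD x
    | succ m ih =>
      intro D hD0 hD x
      refine (ih (D * (a / 8)) (by positivity) (fun y => ?_) x).trans_eq (by ring)
      rw [hrec m y, norm_neg]
      refine (norm_convolution_le_of_submul hw hD0 hiw₂ (Eventually.of_forall hD) y).trans ?_
      have := hw0 y
      gcongr
  have hlim : Tendsto (fun m : ℕ => C * K * (1 / 2) ^ m * w 0) atTop (𝓝 0) := by
    have := (tendsto_pow_atTop_nhds_zero_of_lt_one (r := (1 / 2 : ℝ)) (by norm_num)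
      (by norm_num)).const_mul (C * K) |>.mul_const (w 0)
    simpa using this
  have hbound : ∀ m : ℕ, ‖ψ 0 0‖ ≤ C * K * (1 / 2) ^ m * w 0 := by
    intro m
    refine (hdecay m (C * (K * (4 / a) ^ m)) (by positivity) (fun x => (hψ m x).trans ?_) 0).trans_eq
      ?_
    · have := hw0 x
      gcongr
      exact hK m
    · have : (1 / 2 : ℝ) ^ m = (4 / a) ^ m * (a / 8) ^ m := by
        rw [← mul_pow]
        congr 1
        field_simp
        norm_num
      rw [this]
      ring
  exact norm_le_zero_iff.1 (ge_of_tendsto' hlim hbound)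

end Local

/-! ### The two inclusions between spectrum and support -/

namespace BeurlingSpectrum

variable {n : ℕ}

theorem fourier_involution (f : EuclideanSpace ℝ (Fin n) → ℂ) (γ : EuclideanSpace ℝ (Fin n)) :
    𝓕 (involution f) γ = conj (𝓕 f γ) := by
  rw [Real.fourier_eq, Real.fourier_eq, ← integral_conj, ← integral_neg_eq_self]
  refine integral_congr_ae (Eventually.of_forall fun y => ?_)
  simp only [involution, neg_neg, inner_neg_left, Circle.smul_def, smul_eq_mul, map_mul,
    ← Circle.coe_inv_eq_conj, ← AddChar.map_neg_eq_inv]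

theorem MemLinftyW.exists_ae_le {w : EuclideanSpace ℝ (Fin n) → ℝ} (hw : IsWeight w)
    {φ : EuclideanSpace ℝ (Fin n) → ℂ} (hφ : MemLinftyW w φ) :
    ∃ C : ℝ, 0 ≤ C ∧ ∀ᵐ x, ‖φ x‖ ≤ C * w x := by
  obtain ⟨-, C, hC⟩ := hφ
  refine ⟨|C|, abs_nonneg C, ?_⟩
  filter_upwards [hC] with x hx
  rw [div_le_iff₀ (hw.pos x)] at hx
  exact hx.trans (mul_le_mul_of_nonneg_right (le_abs_self C) (hw.pos x).le)

/-- A bump function outside the support of `𝓕 T` yields an element of the annihilator. -/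
theorem beurlingSpectrum_subset_dsupport {w : EuclideanSpace ℝ (Fin n) → ℝ}
    (hS : ∀ g : 𝓢(EuclideanSpace ℝ (Fin n), ℂ), ⇑g ∈ L1w w)
    {φ : EuclideanSpace ℝ (Fin n) → ℂ} {T : 𝓢'(EuclideanSpace ℝ (Fin n), ℂ)}
    (hT : IsDistributionOf T φ) :
    beurlingSpectrum w φ ⊆
      Distribution.dsupport (𝓕 T : 𝓢'(EuclideanSpace ℝ (Fin n), ℂ)) := by
  intro γ hγ
  by_contra hγT
  obtain ⟨U, hU, hUo, hγU⟩ := (Distribution.notMem_dsupport_iff γ).1 hγT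
  obtain ⟨ρ, hρ, hball⟩ := Metric.isOpen_iff.1 hUo γ hγU
  let χ : ContDiffBump γ := ⟨ρ / 4, ρ / 2, by positivity, by linarith⟩
  have hχc : HasCompactSupport fun ξ => (χ ξ : ℂ) :=
    χ.hasCompactSupport.comp_left Complex.ofReal_zero
  let g : 𝓢(EuclideanSpace ℝ (Fin n), ℂ) :=
    hχc.toSchwartzMap (Complex.ofRealCLM.contDiff.comp χ.contDiff)
  have hg : ∀ ξ, g ξ = (χ ξ : ℂ) := fun ξ => rfl
  have hgU : tsupport g ⊆ U := by
    refine (closure_mono fun ξ hξ => ?_).trans (χ.tsupport_eq.trans_subset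
      ((Metric.closedBall_subset_ball (by simp only [χ]; linarith)).trans hball))
    simpa [hg] using hξ
  have hfA : ⇑(𝓕⁻ g : 𝓢(EuclideanSpace ℝ (Fin n), ℂ)) ∈ annihilator (L1w w) φ := by
    refine ⟨hS _, Eventually.of_forall fun x => ?_⟩
    -- The Fourier transform at `y` of this modulated bump is the involution of `𝓕⁻ g` at `x - y`,
    -- so `𝓕 T` tested on it gives the convolution at `x`.
    have hmc : HasCompactSupport fun ξ => (Real.fourierChar (inner ℝ ξ x) : ℂ) * (χ ξ : ℂ) :=
      hχc.mul_left
    have hms : ContDiff ℝ ∞ fun ξ : EuclideanSpace ℝ (Fin n) =>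
        (Real.fourierChar (inner ℝ ξ x) : ℂ) * (χ ξ : ℂ) := by
      simp only [Real.fourierChar_apply]
      have h1 : ContDiff ℝ ∞ fun ξ : EuclideanSpace ℝ (Fin n) => inner ℝ ξ x :=
        contDiff_id.inner ℝ contDiff_const
      have h2 : ContDiff ℝ ∞ fun ξ : EuclideanSpace ℝ (Fin n) =>
          ((2 * Real.pi * inner ℝ ξ x : ℝ) : ℂ) :=
        Complex.ofRealCLM.contDiff.comp (contDiff_const.mul h1)
      exact (h2.mul contDiff_const).cexp.mul (Complex.ofRealCLM.contDiff.comp χ.contDiff)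
    have hz := hU (hmc.toSchwartzMap hms) ((tsupport_mul_subset_right).trans hgU)
    rw [TemperedDistribution.fourier_apply, (hT _).2] at hz
    rw [← hz, ← integral_sub_left_eq_self _ volume x]
    refine integral_congr_ae (Eventually.of_forall fun y => ?_)
    simp only [sub_sub_cancel]
    congr 1
    rw [involution, SchwartzMap.fourierInv_coe, SchwartzMap.fourier_coe, Real.fourierInv_eq,
      Real.fourier_eq, ← integral_conj]
    refine integral_congr_ae (Eventually.of_forall fun ξ => ?_)
    simp only [hg, HasCompactSupport.toSchwartzMap_toFun, Circle.smul_def, smul_eq_mul, map_mul,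
      Complex.conj_ofReal, ← Circle.coe_inv_eq_conj, ← AddChar.map_neg_eq_inv]
    rw [← mul_assoc, ← Circle.coe_mul, ← AddChar.map_add_eq_mul, inner_neg_right, neg_neg,
      inner_sub_right, sub_eq_neg_add]
  have h0 := hγ _ hfA
  rw [← SchwartzMap.fourier_coe, FourierTransform.fourier_fourierInv_eq, hg,
    χ.one_of_mem_closedBall (Metric.mem_closedBall_self χ.rIn_pos.le)] at h0
  exact one_ne_zero (Complex.ofReal_eq_zero.1 h0)

/-- The local form of Wiener's lemma shows that `𝓕 T` vanishes off the Beurling spectrum. -/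
theorem dsupport_subset_beurlingSpectrum {w : EuclideanSpace ℝ (Fin n) → ℝ} (hw : IsWeight w)
    (hS : ∀ g : 𝓢(EuclideanSpace ℝ (Fin n), ℂ), ⇑g ∈ L1w w)
    {φ : EuclideanSpace ℝ (Fin n) → ℂ} (hφ : MemLinftyW w φ)
    {T : 𝓢'(EuclideanSpace ℝ (Fin n), ℂ)} (hT : IsDistributionOf T φ) :
    Distribution.dsupport (𝓕 T : 𝓢'(EuclideanSpace ℝ (Fin n), ℂ)) ⊆ beurlingSpectrum w φ := by
  intro γ hγT f hf
  by_contra hfγ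
  obtain ⟨⟨hf1, hfw⟩, hfφ⟩ := hf
  obtain ⟨A, N, -, hwN⟩ := hw.exists_le_pow hS
  obtain ⟨C, hC, hφC⟩ := hφ.exists_ae_le hw
  have hi : Integrable (involution f) := by
    refine (hf1.comp_neg.norm).mono' ?_ (Eventually.of_forall fun x => ?_)
    · exact Complex.continuous_conj.comp_aestronglyMeasurable hf1.comp_neg.1
    · simp [involution]
  have hiw : Integrable fun y => ‖involution f y‖ * w (-y) := by
    simpa [involution] using hfw.comp_neg
  have hγ' : 𝓕 (involution f) γ ≠ 0 := by
    rw [fourier_involution]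
    exact (map_ne_zero _).2 hfγ
  obtain ⟨r, hr, hg⟩ := exists_forall_convolution_fourierInv_eq_zero hw.one_le hw.submul
    hw.memLinftyLoc.aestronglyMeasurable hwN hC hφ.1.aestronglyMeasurable hφC hi hiw hfφ hγ'
  refine (Distribution.notMem_dsupport_iff γ).2
    ⟨Metric.ball γ r, fun g hgs => ?_, Metric.isOpen_ball, Metric.mem_ball_self hr⟩ hγT
  -- The reflection `y ↦ -y` turns `𝓕⁻ g` into `𝓕 g`, so the convolution at `0` is `T (𝓕 g)`.
  rw [TemperedDistribution.fourier_apply, (hT _).2, ← hg g hgs, ← integral_neg_eq_self]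
  refine integral_congr_ae (Eventually.of_forall fun y => ?_)
  simp [SchwartzMap.fourierInv_apply_eq]

end BeurlingSpectrum

/-- The hypothesis `hBD` is not needed: the inclusion of the Schwartz space in `L¹_w` already forces
`w` to grow polynomially, which implies the Beurling-Domar condition. -/
theorem proposition2p6 (n : ℕ) (w : EuclideanSpace ℝ (Fin n) → ℝ)
    (hw : BeurlingSpectrum.IsWeight w) (hBD : BeurlingSpectrum.BeurlingDomar w)
    (hS : ∀ g : 𝓢(EuclideanSpace ℝ (Fin n), ℂ), ⇑g ∈ BeurlingSpectrum.L1w w)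
    (φ : EuclideanSpace ℝ (Fin n) → ℂ) (hφ : BeurlingSpectrum.MemLinftyW w φ) :
    ∃ T : 𝓢'(EuclideanSpace ℝ (Fin n), ℂ), BeurlingSpectrum.IsDistributionOf T φ ∧
      BeurlingSpectrum.beurlingSpectrum w φ = Distribution.dsupport (𝓕 T : 𝓢'(EuclideanSpace ℝ (Fin n), ℂ)) := by
  obtain ⟨A, N, hA, hwN⟩ := hw.exists_le_pow hS
  obtain ⟨C, hC, hφC⟩ := hφ.exists_ae_le hw
  have hb : ∀ᵐ x, ‖φ x‖ ≤ C * A * (1 + ‖x‖) ^ N := by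
    filter_upwards [hφC] with x hx
    rw [mul_assoc]
    exact hx.trans (mul_le_mul_of_nonneg_left (hwN x) hC)
  obtain ⟨T, hT⟩ := TemperedDistribution.exists_forall_eq_integral_mul hφ.1.aestronglyMeasurable hb
  exact ⟨T, hT, (BeurlingSpectrum.beurlingSpectrum_subset_dsupport hS hT).antisymm
    (BeurlingSpectrum.dsupport_subset_beurlingSpectrum hw hS hφ hT)⟩
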